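/- For a finite graph $G$ let $\chi_G(n)$ denote its chromatic polynomial, i.e. the unique polynomial whose value at each $n\in\mathbb N=\{0,1,2,\dots\}$ is the number of proper colorings of the vertices of $G$ with $n$ colors. A numerical polynomial is a $g\in\mathbb Q[x]$ with $g(q)\in\mathbb Z$ for all $q\in\mathbb Z$. Let $g$ be a numerical polynomial that is eventually nonnegative, let $S=\{q\in\mathbb N: g(q)\ge 0\}$, and let $e:S\to\mathbb N\cup\{-1,\infty\}$. A two-level polynomial of degree $g$ and depth $e$ is a sequence of polynomials $\{f_q(n)\}_{q\in S}$ in $\mathbb Q[n]$, with $f_q$ of degree $g(q)$, such that, writing $f_q(n)=\sum_{r\ge 0}c_r(q)\,n^{g(q)-r}$ with $c_r(q)=0$ for $r>g(q)$, there exist polynomials $\phi_0,\phi_1,\phi_2,\dots\in\mathbb Q[x]$ with $c_r(q)=\phi_r(q)$ for every $q\in S$ and every $r\in\mathbb N$ with $r\le e(q)$; for $q\in\mathbb N\setminus S$ one sets $f_q=0$ and $e(q)=-1$. It has infinite depth if $e(q)=\infty$ for all $q\in S$. Theorem. Fix $k\in\mathbb N$, and for each $q\in\mathbb N$ let $G_q=K_q^k$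 be the Cartesian product of $k$ copies of the complete graph $K_q$ (its vertices are the $k$-tuples of elements of $\{1,\dots,q\}$, two tuples being adjacent if and only if they differ in exactly one index). Then $\{\chi_{G_q}(n)\}_{q\in\mathbb N}$ is a two-level polynomial of degree $q^k$ and infinite depth. That is, $\chi_{G_q}$ has degree $q^k$ for every $q\in\mathbb N$, and there are polynomials $\phi_r\in\mathbb Q[x]$, $r\in\mathbb N$, such that for all $q,r\in\mathbb N$ the number $\phi_r(q)$ is the coefficient of $n^{q^k-r}$ in $\chi_{G_q}(n)$ if $r\le q^k$, and is $0$ if $r>q^k$. -/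

import Mathlib

open Polynomial

/-! ### Numerical polynomials and two-level polynomials -/

/-- A numerical polynomial: a polynomial with rational coefficients that takes integer values
at all integers. -/
def IsNumericalPolynomial (g : ℚ[X]) : Prop :=
  ∀ q : ℤ, ∃ m : ℤ, g.eval (q : ℚ) = (m : ℚ)

/-- The codegree `r` coefficient of `p`: the coefficient of degree `deg p - r`, which is `0` by
convention when `r > deg p`. -/
noncomputable def codegreeCoeff (p : ℚ[X]) (r : ℕ) : ℚ :=
  if r ≤ p.natDegree then p.coeff (p.natDegree - r) else 0

/-- The sequence `f` of polynomials is a two-level polynomial of degree `g` and depth `e`.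
With `S = {q ∈ ℕ : g q ≥ 0}`, the polynomial `f q` has degree exactly `g q` for all `q ∈ S`, and
there are polynomials `φ r` such that for all `q ∈ S` and all `r ≤ e q` the codegree `r`
coefficient of `f q` equals `φ r` evaluated at `q`. Off `S`, `f q = 0` and `e q = -1`.
Depths live in `ℕ ∪ {-1, ∞}`, which is `WithBot ℕ∞` with `⊥` for `-1` and `⊤` for `∞`. -/
structure IsTwoLevelPolynomial (g : ℚ[X]) (e : ℕ → WithBot ℕ∞) (f : ℕ → ℚ[X]) : Prop where
  numerical : IsNumericalPolynomial g
  eventually_nonneg : ∀ᶠ q : ℕ in Filter.atTop, 0 ≤ g.eval (q : ℚ)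
  degree_eq : ∀ q : ℕ, 0 ≤ g.eval (q : ℚ) →
    f q ≠ 0 ∧ ((f q).natDegree : ℚ) = g.eval (q : ℚ)
  exists_coeff : ∃ φ : ℕ → ℚ[X], ∀ q : ℕ, 0 ≤ g.eval (q : ℚ) →
    ∀ r : ℕ, ((r : ℕ∞) : WithBot ℕ∞) ≤ e q → codegreeCoeff (f q) r = (φ r).eval (q : ℚ)
  eq_zero : ∀ q : ℕ, g.eval (q : ℚ) < 0 → f q = 0 ∧ e q = ⊥

/-! ### Chromatic polynomials -/

/-- `p` takes at each natural number `n` the number of proper colorings of `G` with `n` colors. -/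
def IsChromaticPolynomial {V : Type*} (G : SimpleGraph V) (p : ℚ[X]) : Prop :=
  ∀ n : ℕ, p.eval (n : ℚ) = (Nat.card (G.Coloring (Fin n)) : ℚ)

theorem IsChromaticPolynomial.unique {V : Type*} {G : SimpleGraph V} {p p' : ℚ[X]}
    (h : IsChromaticPolynomial G p) (h' : IsChromaticPolynomial G p') : p = p' := by
  refine Polynomial.eq_of_infinite_eval_eq p p' ?_
  refine (Set.infinite_range_of_injective (Nat.cast_injective (R := ℚ))).mono ?_
  rintro _ ⟨n, rfl⟩
  exact (h n).trans (h' n).symm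

/-- The number of maps `V → Fin n` whose fibres form exactly the partition `s`. -/
theorem card_ker_eq {V : Type*} [Finite V] (s : Setoid V) (n : ℕ) :
    Nat.card {f : V → Fin n // Setoid.ker f = s}
      = n.descFactorial (Nat.card (Quotient s)) := by
  classical
  have : Fintype (Quotient s) := Fintype.ofFinite _
  have e : {f : V → Fin n // Setoid.ker f = s} ≃ (Quotient s ↪ Fin n) :=
    { toFun := fun f => ⟨Quotient.lift f.1 (fun a b hab => by
          have : (Setoid.ker f.1) a b := by rw [f.2]; exact hab
          exact this), by
        rintro ⟨a⟩ ⟨b⟩ hab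
        refine Quotient.sound ?_
        have : (Setoid.ker f.1) a b := hab
        rw [f.2] at this
        exact this⟩
      invFun := fun c => ⟨fun v => c (Quotient.mk s v), by
        ext a b
        rw [Setoid.ker_def, c.injective.eq_iff]
        exact Quotient.eq⟩
      left_inv := fun f => by ext v; rfl
      right_inv := fun c => by ext ⟨v⟩; rfl }
  rw [Nat.card_congr e, Nat.card_eq_fintype_card, Fintype.card_embedding_eq, Fintype.card_fin,
    Nat.card_eq_fintype_card]

theorem exists_isChromaticPolynomial {V : Type*} [Finite V] (G : SimpleGraph V) :
    ∃ p : ℚ[X], IsChromaticPolynomial G p := by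
  classical
  have : Fintype V := Fintype.ofFinite V
  have : Finite (Setoid V) := Finite.of_injective (fun s : Setoid V => (fun a b => s a b))
    (fun s t h => Setoid.ext fun a b => iff_of_eq (congrFun (congrFun h a) b))
  let I := {s : Setoid V // ∀ a b, G.Adj a b → ¬ s a b}
  have : Fintype I := Fintype.ofFinite I
  refine ⟨∑ s : I, descPochhammer ℚ (Nat.card (Quotient s.1)), fun n => ?_⟩
  have e : G.Coloring (Fin n) ≃ Σ s : I, {f : V → Fin n // Setoid.ker f = s.1} :=
    { toFun := fun c => ⟨⟨Setoid.ker c, fun a b hab h => c.valid hab h⟩, ⟨c, rfl⟩⟩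
      invFun := fun x => SimpleGraph.Coloring.mk x.2.1 (fun {a b} hab h =>
        x.1.2 a b hab (by rw [← x.2.2]; exact h))
      left_inv := fun c => by ext v; rfl
      right_inv := by rintro ⟨⟨s, hs⟩, ⟨f, h⟩⟩; change Setoid.ker f = s at h; subst h; rfl }
  rw [Nat.card_congr e, Nat.card_sigma]
  simp only [card_ker_eq, eval_finsetSum, descPochhammer_eval_eq_descFactorial, Nat.cast_sum]

/-- The chromatic polynomial of a finite graph: the unique polynomial whose value at each natural
number `n` is the number of proper colorings of `G` with `n` colors. -/
noncomputable def chromaticPolynomial {V : Type*} [Finite V] (G : SimpleGraph V) : ℚ[X] :=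
  Classical.choose (exists_isChromaticPolynomial G)

theorem isChromaticPolynomial_chromaticPolynomial {V : Type*} [Finite V] (G : SimpleGraph V) :
    IsChromaticPolynomial G (chromaticPolynomial G) :=
  Classical.choose_spec (exists_isChromaticPolynomial G)

/-! ### Cartesian powers -/

/-- The Cartesian product of `k` copies of `G`: the vertices are the `k`-tuples of vertices of `G`,
two of them being adjacent when they are adjacent in `G` at one index and agree at all others. -/
def SimpleGraph.cartesianPower {V : Type*} (G : SimpleGraph V) (k : ℕ) :
    SimpleGraph (Fin k → V) where
  Adj u v := ∃ i : Fin k, G.Adj (u i) (v i) ∧ ∀ j : Fin k, j ≠ i → u j = v j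
  symm := ⟨fun _ _ ⟨i, hi, hj⟩ => ⟨i, hi.symm, fun j h => (hj j h).symm⟩⟩
  loopless := ⟨fun _ ⟨_, hi, _⟩ => G.irrefl hi⟩

/-! By Whitney's expansion, the codegree `r` coefficient is the sum of `(-1) ^ |A|` over edge sets
`A` of rank `r`, the rank being the number of vertices minus the number of components. Such an `A`
touches at most `2r` vertices, hence involves at most `2rk` coordinate values, a bound independent
of `q`. Group the sets `A` by the set `S` of values they involve. Relabelling values and adding
isolated vertices change neither rank nor sign, so the contribution of `S` depends only on its size
`s`. The coefficient is therefore a sum over `s ≤ 2rk` of `q.choose s` times a constant, a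
polynomial in `q` (`sum_rank_eq_sum_choose`). -/

/-! ### Whitney's subgraph expansion -/

/-- The number of connected components of the graph with edge set `A`. -/
noncomputable def edgeComponents {V : Type*} (A : Finset (Sym2 V)) : ℕ :=
  Nat.card (SimpleGraph.fromEdgeSet (A : Set (Sym2 V))).ConnectedComponent

/-- Functions constant along the edges in `A` are functions on the connected components. -/
noncomputable def constantOnEdgesEquiv {V β : Type*} (A : Finset (Sym2 V)) :
    {f : V → β // ∀ e ∈ A, (e.map f).IsDiag} ≃
      ((SimpleGraph.fromEdgeSet (A : Set (Sym2 V))).ConnectedComponent → β) where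
  toFun f := SimpleGraph.ConnectedComponent.lift f.1 (by
    intro v w p hp
    clear hp
    induction p with
    | nil => rfl
    | cons h _ ih =>
      rw [← ih]
      exact f.2 _ ((SimpleGraph.fromEdgeSet_adj _).1 h).1)
  invFun g := ⟨fun v => g (SimpleGraph.connectedComponentMk _ v), by
    intro e
    induction e with | _ u v =>
    intro he
    rw [Sym2.map_mk, Sym2.mk_isDiag_iff]
    by_cases huv : u = v
    · rw [huv]
    · congr 1
      exact SimpleGraph.ConnectedComponent.sound
        (SimpleGraph.Adj.reachable ((SimpleGraph.fromEdgeSet_adj _).2 ⟨he, huv⟩))⟩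
  left_inv f := rfl
  right_inv g := by
    ext c
    induction c using SimpleGraph.ConnectedComponent.ind
    rfl

theorem card_constantOnEdges {V : Type*} [Finite V] (A : Finset (Sym2 V)) (n : ℕ) :
    Nat.card {f : V → Fin n // ∀ e ∈ A, (e.map f).IsDiag} = n ^ edgeComponents A := by
  rw [Nat.card_congr (constantOnEdgesEquiv A), Nat.card_fun, Nat.card_fin, edgeComponents]

/-- Whitney's subgraph expansion of the chromatic polynomial. -/
theorem chromaticPolynomial_eq_sum {V : Type*} [Finite V] (G : SimpleGraph V)
    (E : Finset (Sym2 V)) (hE : ∀ e, e ∈ E ↔ e ∈ G.edgeSet) :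
    chromaticPolynomial G = ∑ A ∈ E.powerset, C ((-1) ^ A.card) * X ^ edgeComponents A := by
  classical
  have : Fintype V := Fintype.ofFinite V
  refine (isChromaticPolynomial_chromaticPolynomial G).unique fun n => ?_
  have hcol : Nat.card (G.Coloring (Fin n)) =
      Nat.card {f : V → Fin n // ∀ e ∈ E, ¬ (e.map f).IsDiag} := by
    refine Nat.card_congr ⟨fun c => ⟨c, fun e => ?_⟩, fun f => SimpleGraph.Coloring.mk f.1 ?_,
      fun _ => rfl, fun _ => rfl⟩
    · induction e with | _ u v =>
      intro he
      exact c.valid ((hE _).1 he)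
    · intro u v huv
      exact f.2 s(u, v) ((hE _).2 huv)
  have hprod : ∀ f : V → Fin n, (if ∀ e ∈ E, ¬ (e.map f).IsDiag then (1 : ℚ) else 0) =
      ∑ A ∈ E.powerset, (-1) ^ A.card * if ∀ e ∈ A, (e.map f).IsDiag then (1 : ℚ) else 0 := by
    intro f
    -- Inclusion-exclusion: each edge contributes a factor `1 - [e is monochromatic]`, and the
    -- product is expanded over subsets.
    have h1 : (if ∀ e ∈ E, ¬ (e.map f).IsDiag then (1 : ℚ) else 0) =
        ∏ e ∈ E, (1 + -(if (e.map f).IsDiag then (1 : ℚ) else 0)) := by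
      refine (Eq.trans (by congr) (Finset.prod_boole (s := E)
        (p := fun e => ¬ (e.map f).IsDiag)).symm).trans ?_
      refine Finset.prod_congr rfl fun e _ => ?_
      by_cases h : (e.map f).IsDiag <;> simp [h]
    rw [h1, Finset.prod_one_add]
    refine Finset.sum_congr rfl fun A _ => ?_
    rw [Finset.prod_neg, Finset.prod_boole]
    congr
  have hcount : ∀ (P : (V → Fin n) → Prop) [DecidablePred P], (Nat.card {f // P f} : ℚ) =
      ∑ f, if P f then (1 : ℚ) else 0 := by
    intro P _
    rw [Nat.card_eq_fintype_card, Fintype.card_subtype, Finset.sum_boole]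
  rw [hcol, hcount, Finset.sum_congr rfl fun f _ => hprod f, Finset.sum_comm, eval_finsetSum]
  refine Finset.sum_congr rfl fun A _ => ?_
  rw [← Finset.mul_sum, ← hcount, card_constantOnEdges]
  simp

/-! ### Components, isolated vertices and rank -/

theorem edgeComponents_empty {V : Type*} [Finite V] :
    edgeComponents (∅ : Finset (Sym2 V)) = Nat.card V := by
  -- Two colors suffice: the component count is read off as an exponent of 2.
  have h := card_constantOnEdges (∅ : Finset (Sym2 V)) 2
  have e : {f : V → Fin 2 // ∀ e ∈ (∅ : Finset (Sym2 V)), (e.map f).IsDiag} ≃ (V → Fin 2) :=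
    Equiv.subtypeUnivEquiv (by simp)
  rw [Nat.card_congr e, Nat.card_fun, Nat.card_fin] at h
  exact (Nat.pow_right_injective le_rfl h).symm

theorem edgeComponents_le {V : Type*} [Finite V] (A : Finset (Sym2 V)) :
    edgeComponents A ≤ Nat.card V :=
  Nat.card_le_card_of_surjective _ Quot.mk_surjective

/-- Embedding the vertices into a larger set adds only isolated vertices. -/
theorem edgeComponents_map {V W : Type*} [Finite V] [Finite W] (φ : V ↪ W)
    (A : Finset (Sym2 V)) :
    edgeComponents (A.map φ.sym2Map) + Nat.card V = edgeComponents A + Nat.card W := by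
  classical
  have h := card_constantOnEdges (A.map φ.sym2Map) 2
  -- Off the range of `φ` the coloring is free; on it, the only constraints are those of `A`.
  have e : {f : W → Fin 2 // ∀ e ∈ A.map φ.sym2Map, (e.map f).IsDiag} ≃
      {f : V → Fin 2 // ∀ e ∈ A, (e.map f).IsDiag} × ({w // ¬ w ∈ Set.range φ} → Fin 2) := by
    refine Equiv.trans (Equiv.subtypeEquiv ((Equiv.piEquivPiSubtypeProd (· ∈ Set.range φ) _).trans
      (Equiv.prodCongrLeft fun _ => Equiv.arrowCongr (Equiv.ofInjective φ φ.injective).symm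
        (Equiv.refl _)))
      (q := fun x => ∀ e ∈ A, (e.map x.1).IsDiag) ?_) (Equiv.prodSubtypeFstEquivSubtypeProd
        (p := fun f : V → Fin 2 => ∀ e ∈ A, (e.map f).IsDiag))
    intro f
    simp only [Finset.mem_map, forall_exists_index, and_imp, forall_apply_eq_imp_iff₂]
    refine forall₂_congr fun e _ => ?_
    rw [Function.Embedding.sym2Map_apply, Sym2.map_map]
    rfl
  rw [Nat.card_congr e, Nat.card_prod, card_constantOnEdges, Nat.card_fun, Nat.card_fin,
    ← pow_add] at h
  have h2 := Nat.pow_right_injective le_rfl h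
  have h3 : Nat.card {w // w ∈ Set.range φ} + Nat.card {w // ¬ w ∈ Set.range φ} = Nat.card W := by
    rw [← Nat.card_sum, Nat.card_congr (Equiv.sumCompl _)]
  have h4 : Nat.card V = Nat.card {w // w ∈ Set.range φ} :=
    Nat.card_congr (Equiv.ofInjective φ φ.injective)
  omega

/-- The vertices covered by loopless edges are at most twice the rank. -/
theorem two_mul_edgeComponents_add_card_le {V : Type*} [Fintype V] (A : Finset (Sym2 V))
    (hA : ∀ e ∈ A, ¬ e.IsDiag) (W : Finset V) (hW : ∀ v ∈ W, ∃ e ∈ A, v ∈ e) :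
    2 * edgeComponents A + W.card ≤ 2 * Fintype.card V := by
  classical
  set G := SimpleGraph.fromEdgeSet (A : Set (Sym2 V)) with hG
  -- A component meeting `W` has at least two vertices; any other has a vertex outside `W`, counted
  -- in both terms.
  have hfib : ∀ c : G.ConnectedComponent, 2 ≤
      (Finset.univ.filter fun v => G.connectedComponentMk v = c).card +
        (Wᶜ.filter fun v => G.connectedComponentMk v = c).card := by
    intro c
    induction c using SimpleGraph.ConnectedComponent.ind with | _ v =>
    by_cases hv : v ∈ W
    · obtain ⟨e, heA, hve⟩ := hW v hv
      obtain ⟨u, rfl⟩ := hve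
      have huv : v ≠ u := fun h => hA _ heA h
      have hadj : G.Adj v u := (SimpleGraph.fromEdgeSet_adj _).2 ⟨heA, huv⟩
      refine le_add_right (Finset.one_lt_card.2 ⟨v, by simp, u, ?_, huv⟩)
      simpa using hadj.reachable.symm
    · refine show 1 + 1 ≤ _ from add_le_add ?_ ?_ <;>
      exact Finset.card_pos.2 ⟨v, by simp [hv]⟩
  have hsum := Finset.sum_le_sum fun c (_ : c ∈ (Finset.univ : Finset G.ConnectedComponent)) => hfib c
  rw [Finset.sum_add_distrib,
    ← Finset.card_eq_sum_card_fiberwise (f := G.connectedComponentMk) (by simp),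
    ← Finset.card_eq_sum_card_fiberwise (f := G.connectedComponentMk) (by simp), Finset.sum_const, Finset.card_compl,
    Finset.card_univ, Finset.card_univ] at hsum
  have hc : edgeComponents A = Fintype.card G.ConnectedComponent := Nat.card_eq_fintype_card
  have := Finset.card_le_univ W
  simp only [smul_eq_mul] at hsum
  omega

/-! ### Coordinate support of an edge set -/

/-- The edges of the Cartesian power `K_α ^ k`. -/
noncomputable def hammingEdges (α : Type*) [Finite α] (k : ℕ) : Finset (Sym2 (Fin k → α)) :=
  (Set.toFinite ((SimpleGraph.completeGraph α).cartesianPower k).edgeSet).toFinset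

theorem mem_hammingEdges {α : Type*} [Finite α] {k : ℕ} (e : Sym2 (Fin k → α)) :
    e ∈ hammingEdges α k ↔ e ∈ ((SimpleGraph.completeGraph α).cartesianPower k).edgeSet :=
  Set.Finite.mem_toFinset _

theorem not_isDiag_of_mem_hammingEdges {α : Type*} [Finite α] {k : ℕ} {e : Sym2 (Fin k → α)}
    (he : e ∈ hammingEdges α k) : ¬ e.IsDiag :=
  SimpleGraph.not_isDiag_of_mem_edgeSet _ ((mem_hammingEdges e).1 he)

open Classical in
/-- The values occurring as a coordinate of an endpoint of an edge in `A`. -/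
noncomputable def coordSupport {α : Type*} [Fintype α] {k : ℕ}
    (A : Finset (Sym2 (Fin k → α))) : Finset α :=
  Finset.univ.filter fun x => ∃ e ∈ A, ∃ v ∈ e, ∃ i, v i = x

theorem mem_coordSupport {α : Type*} [Fintype α] {k : ℕ} {A : Finset (Sym2 (Fin k → α))} {x : α} :
    x ∈ coordSupport A ↔ ∃ e ∈ A, ∃ v ∈ e, ∃ i, v i = x := by
  simp [coordSupport]

/-- Applying an embedding to every coordinate. -/
def coordEmbedding {α β : Type*} (k : ℕ) (φ : α ↪ β) : (Fin k → α) ↪ (Fin k → β) :=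
  ⟨fun v i => φ (v i), fun _ _ h => funext fun i => φ.injective (congrFun h i)⟩

theorem sym2Map_coordEmbedding_mem_hammingEdges {α β : Type*} [Finite α] [Finite β] {k : ℕ}
    (φ : α ↪ β) (e : Sym2 (Fin k → α)) :
    (coordEmbedding k φ).sym2Map e ∈ hammingEdges β k ↔ e ∈ hammingEdges α k := by
  induction e with | _ u v =>
  rw [mem_hammingEdges, mem_hammingEdges, Function.Embedding.sym2Map_apply, Sym2.map_mk,
    SimpleGraph.mem_edgeSet, SimpleGraph.mem_edgeSet]
  have happ : ∀ (w : Fin k → α) (i : Fin k), coordEmbedding k φ w i = φ (w i) := fun _ _ => rfl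
  simp [SimpleGraph.cartesianPower, happ]

theorem coordSupport_map {α β : Type*} [Fintype α] [Fintype β] {k : ℕ} (φ : α ↪ β)
    (A : Finset (Sym2 (Fin k → α))) :
    coordSupport (A.map (coordEmbedding k φ).sym2Map) = (coordSupport A).map φ := by
  ext x
  simp only [mem_coordSupport, Finset.mem_map, Function.Embedding.sym2Map_apply]
  constructor
  · rintro ⟨_, ⟨e, he, rfl⟩, v, hv, i, rfl⟩
    obtain ⟨u, hu, rfl⟩ := Sym2.mem_map.1 hv
    exact ⟨u i, ⟨e, he, u, hu, i, rfl⟩, rfl⟩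
  · rintro ⟨_, ⟨e, he, u, hu, i, rfl⟩, rfl⟩
    exact ⟨_, ⟨e, he, rfl⟩, _, Sym2.mem_map.2 ⟨u, hu, rfl⟩, i, rfl⟩

/-- An edge set with coordinates in the range of `φ` comes from the smaller Cartesian power. -/
theorem exists_map_eq_of_coordSupport {α β : Type*} [Fintype α] [Fintype β] {k : ℕ} (φ : α ↪ β)
    (A : Finset (Sym2 (Fin k → β))) (hA : ∀ x ∈ coordSupport A, x ∈ Set.range φ) :
    ∃ B : Finset (Sym2 (Fin k → α)), B.map (coordEmbedding k φ).sym2Map = A := by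
  have hsub : (A : Set (Sym2 (Fin k → β))) ⊆ Set.range (coordEmbedding k φ).sym2Map := by
    intro e he
    have hv : ∀ v ∈ e, ∃ u, coordEmbedding k φ u = v := by
      intro v hv
      choose u hu using fun i => hA (v i) (mem_coordSupport.2 ⟨e, he, v, hv, i, rfl⟩)
      exact ⟨u, funext hu⟩
    induction e with | _ a b =>
    obtain ⟨a, rfl⟩ := hv a (Sym2.mem_mk_left _ _)
    obtain ⟨b, rfl⟩ := hv b (Sym2.mem_mk_right _ _)
    exact ⟨s(a, b), rfl⟩
  classical
  refine ⟨A.preimage _ (coordEmbedding k φ).sym2Map.injective.injOn, ?_⟩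
  rw [Finset.map_eq_image, Finset.image_preimage]
  exact Finset.filter_true_of_mem fun e he => hsub he

/-- A rank `r` set of edges involves at most `2rk` coordinate values. -/
theorem card_coordSupport_le {α : Type*} [Fintype α] {k r : ℕ} {A : Finset (Sym2 (Fin k → α))}
    (hA : ∀ e ∈ A, ¬ e.IsDiag) (hr : edgeComponents A + r = Fintype.card α ^ k) :
    (coordSupport A).card ≤ 2 * r * k := by
  classical
  set W : Finset (Fin k → α) := Finset.univ.filter fun v => ∃ e ∈ A, v ∈ e with hW
  have h1 := two_mul_edgeComponents_add_card_le A hA W (by simp [hW])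
  have h2 : coordSupport A ⊆ (W ×ˢ (Finset.univ : Finset (Fin k))).image fun p => p.1 p.2 := by
    intro x hx
    obtain ⟨e, he, v, hv, i, rfl⟩ := mem_coordSupport.1 hx
    exact Finset.mem_image.2 ⟨(v, i), by simpa [hW] using ⟨e, he, hv⟩, rfl⟩
  have h3 := (Finset.card_le_card h2).trans Finset.card_image_le
  rw [Finset.card_product, Finset.card_univ, Fintype.card_fin] at h3
  rw [Fintype.card_fun, Fintype.card_fin] at h1
  exact h3.trans (Nat.mul_le_mul_right k (by omega))

/-! ### Polynomial dependence on `q` -/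

open Classical in
/-- The signed number of rank `r` edge sets of `K_α ^ k` with coordinate support `S`. -/
noncomputable def signedCount {α : Type*} [Fintype α] (k r : ℕ) (S : Finset α) : ℚ :=
  ∑ A ∈ (hammingEdges α k).powerset with
    coordSupport A = S ∧ edgeComponents A + r = Fintype.card α ^ k, (-1) ^ A.card

/-- Pushing edge sets forward along `φ` is a sign-preserving bijection: the new vertices are
isolated, so the rank is unchanged, and support in the image of `φ` forces an edge set to come from
`α`. -/
theorem signedCount_map {α β : Type*} [Fintype α] [Fintype β] (k r : ℕ) (φ : α ↪ β)
    (S : Finset α) : signedCount k r (S.map φ) = signedCount k r S := by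
  symm
  have hcomp : ∀ A : Finset (Sym2 (Fin k → α)),
      edgeComponents (A.map (coordEmbedding k φ).sym2Map) + r = Fintype.card β ^ k ↔
        edgeComponents A + r = Fintype.card α ^ k := by
    intro A
    have h := edgeComponents_map (coordEmbedding k φ) A
    simp only [Nat.card_eq_fintype_card, Fintype.card_fun, Fintype.card_fin] at h
    omega
  have hmem : ∀ A : Finset (Sym2 (Fin k → α)),
      A.map (coordEmbedding k φ).sym2Map ⊆ hammingEdges β k ↔ A ⊆ hammingEdges α k := by
    intro A
    simp only [Finset.subset_iff, Finset.mem_map, forall_exists_index, and_imp,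
      forall_apply_eq_imp_iff₂, sym2Map_coordEmbedding_mem_hammingEdges]
  refine Finset.sum_bij (fun A _ => A.map (coordEmbedding k φ).sym2Map) ?_ ?_ ?_ ?_
  · intro A hA
    simpa only [Finset.mem_filter, Finset.mem_powerset, hmem, hcomp, coordSupport_map,
      Finset.map_inj] using hA
  · intro A _ B _ h
    exact Finset.map_injective _ h
  · intro A hA
    simp only [Finset.mem_filter, Finset.mem_powerset] at hA
    obtain ⟨B, rfl⟩ := exists_map_eq_of_coordSupport φ A (by
      rw [hA.2.1]
      intro x hx
      obtain ⟨y, _, rfl⟩ := Finset.mem_map.1 hx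
      exact ⟨y, rfl⟩)
    refine ⟨B, ?_, rfl⟩
    simpa only [Finset.mem_filter, Finset.mem_powerset, hmem, hcomp, coordSupport_map,
      Finset.map_inj] using hA
  · intro A _
    rw [Finset.card_map]

theorem signedCount_eq_univ {α : Type*} [Fintype α] (k r : ℕ) (S : Finset α) :
    signedCount k r S = signedCount k r (Finset.univ : Finset (Fin S.card)) := by
  rw [← signedCount_map k r (S.equivFin.symm.toEmbedding.trans (Function.Embedding.subtype _))]
  congr 1
  ext x
  simp only [Finset.mem_map, Finset.mem_univ, true_and]
  constructor
  · intro hx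
    exact ⟨S.equivFin ⟨x, hx⟩, by simp⟩
  · rintro ⟨i, rfl⟩
    exact (S.equivFin.symm i).2

theorem signedCount_eq_zero {α : Type*} [Fintype α] {k r : ℕ} {S : Finset α}
    (hS : 2 * r * k < S.card) : signedCount k r S = 0 := by
  refine Finset.sum_eq_zero fun A hA => absurd hS (not_lt.2 ?_)
  simp only [Finset.mem_filter, Finset.mem_powerset] at hA
  rw [← hA.2.1]
  exact card_coordSupport_le (fun e he => not_isDiag_of_mem_hammingEdges (hA.1 he)) hA.2.2

open Classical in
/-- The signed number of rank `r` edge sets of `K_q ^ k` is a polynomial in `q`. -/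
theorem sum_rank_eq_sum_choose (k r q : ℕ) :
    (∑ A ∈ (hammingEdges (Fin q) k).powerset with edgeComponents A + r = q ^ k,
      (-1 : ℚ) ^ A.card) = ∑ s ∈ Finset.range (2 * r * k + 1),
        (q.choose s : ℚ) * signedCount k r (Finset.univ : Finset (Fin s)) := by
  have h1 : (∑ A ∈ (hammingEdges (Fin q) k).powerset with edgeComponents A + r = q ^ k,
      (-1 : ℚ) ^ A.card) =
      ∑ S ∈ (Finset.univ : Finset (Fin q)).powerset, signedCount k r S := by
    rw [← Finset.sum_fiberwise_of_maps_to (g := coordSupport)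
      (fun _ _ => Finset.mem_powerset.2 (Finset.subset_univ _))]
    refine Finset.sum_congr rfl fun S _ => ?_
    rw [Finset.filter_filter, signedCount, Fintype.card_fin]
    refine Finset.sum_congr ?_ fun _ _ => rfl
    ext A
    simp only [Finset.mem_filter]
    tauto
  rw [h1, Finset.sum_congr rfl fun S _ => signedCount_eq_univ k r S,
    Finset.sum_powerset_apply_card
      (fun s => signedCount k r (Finset.univ : Finset (Fin s))), Finset.card_univ, Fintype.card_fin]
  simp only [nsmul_eq_mul]
  -- Both sums extend to a common range: binomials vanish for `s > q`, signed counts for `s > 2 * r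
  -- * k`.
  have hq : Finset.range (q + 1) ⊆ Finset.range (max q (2 * r * k) + 1) :=
    Finset.range_subset_range.2 (by omega)
  have hr : Finset.range (2 * r * k + 1) ⊆ Finset.range (max q (2 * r * k) + 1) :=
    Finset.range_subset_range.2 (by omega)
  rw [Finset.sum_subset hq, Finset.sum_subset hr]
  · intro s _ hs
    rw [signedCount_eq_zero (by simpa [Nat.succ_le_iff] using hs), mul_zero]
  · intro s _ hs
    rw [Nat.choose_eq_zero_of_lt (by simpa [Nat.succ_le_iff] using hs), Nat.cast_zero, zero_mul]

/-- The polynomial in `q` giving the codegree `r` coefficient for `K_q ^ k`. -/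
noncomputable def codegreePolynomial (k r : ℕ) : ℚ[X] :=
  ∑ s ∈ Finset.range (2 * r * k + 1),
    C (signedCount k r (Finset.univ : Finset (Fin s)) / s.factorial) * descPochhammer ℚ s

theorem eval_codegreePolynomial (k r q : ℕ) : (codegreePolynomial k r).eval (q : ℚ) =
    ∑ s ∈ Finset.range (2 * r * k + 1),
      (q.choose s : ℚ) * signedCount k r (Finset.univ : Finset (Fin s)) := by
  rw [codegreePolynomial, eval_finsetSum]
  refine Finset.sum_congr rfl fun s _ => ?_
  rw [eval_mul, eval_C, descPochhammer_eval_eq_descFactorial,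
    Nat.descFactorial_eq_factorial_mul_choose, Nat.cast_mul]
  have : (s.factorial : ℚ) ≠ 0 := Nat.cast_ne_zero.2 s.factorial_ne_zero
  field_simp

/-! ### Degree and coefficients of the chromatic polynomial -/

open Classical in
theorem coeff_chromaticPolynomial {V : Type*} [Finite V] (G : SimpleGraph V)
    (E : Finset (Sym2 V)) (hE : ∀ e, e ∈ E ↔ e ∈ G.edgeSet) (d : ℕ) :
    (chromaticPolynomial G).coeff d =
      ∑ A ∈ E.powerset with edgeComponents A = d, (-1 : ℚ) ^ A.card := by
  rw [chromaticPolynomial_eq_sum G E hE, finsetSum_coeff, Finset.sum_filter]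
  refine Finset.sum_congr rfl fun A _ => ?_
  rw [coeff_C_mul_X_pow]
  simp only [eq_comm]

theorem chromaticPolynomial_natDegree_and_ne_zero {V : Type*} [Finite V] (G : SimpleGraph V) :
    chromaticPolynomial G ≠ 0 ∧ (chromaticPolynomial G).natDegree = Nat.card V := by
  classical
  have : Fintype V := Fintype.ofFinite V
  have hE : ∀ e, e ∈ G.edgeFinset ↔ e ∈ G.edgeSet := fun e => SimpleGraph.mem_edgeFinset
  have hle : (chromaticPolynomial G).natDegree ≤ Nat.card V := by
    rw [natDegree_le_iff_coeff_eq_zero]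
    intro d hd
    rw [coeff_chromaticPolynomial G _ hE, Finset.filter_false_of_mem, Finset.sum_empty]
    intro A _ h
    exact absurd (edgeComponents_le A) (by omega)
  have hcoeff : (chromaticPolynomial G).coeff (Nat.card V) = 1 := by
    rw [coeff_chromaticPolynomial G _ hE, Finset.sum_eq_single ∅]
    · simp
    · intro A hA hne
      exfalso
      simp only [Finset.mem_filter, Finset.mem_powerset] at hA
      obtain ⟨e, he⟩ := Finset.nonempty_iff_ne_empty.2 hne
      induction e with | _ u v =>
      -- One covered vertex already makes the rank positive, so only `∅` contributes to the top
      -- coefficient.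
      have h := two_mul_edgeComponents_add_card_le A
        (fun e he => G.not_isDiag_of_mem_edgeSet ((hE e).1 (hA.1 he))) {u}
        (by simpa using ⟨_, he, Sym2.mem_mk_left u v⟩)
      rw [Finset.card_singleton, hA.2, Nat.card_eq_fintype_card] at h
      omega
    · intro h
      exact absurd (by simp [edgeComponents_empty]) h
  refine ⟨fun h => by simp [h] at hcoeff, le_antisymm hle ?_⟩
  exact le_natDegree_of_ne_zero (by rw [hcoeff]; exact one_ne_zero)

theorem codegreeCoeff_chromaticPolynomial_cartesianPower (k q r : ℕ) :
    codegreeCoeff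
      (chromaticPolynomial ((SimpleGraph.completeGraph (Fin q)).cartesianPower k)) r =
        (codegreePolynomial k r).eval (q : ℚ) := by
  classical
  rw [eval_codegreePolynomial, ← sum_rank_eq_sum_choose, codegreeCoeff,
    (chromaticPolynomial_natDegree_and_ne_zero _).2, Nat.card_fun, Nat.card_fin, Nat.card_fin]
  split_ifs with h
  · rw [coeff_chromaticPolynomial _ _ mem_hammingEdges]
    refine Finset.sum_congr (Finset.filter_congr fun A _ => ?_) fun _ _ => rfl
    omega
  -- For `r > q ^ k` no edge set has rank `r`, which matches the default value 0.
  · rw [Finset.filter_false_of_mem, Finset.sum_empty]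
    intro A _ hA
    omega

theorem mainTheorem3 (k : ℕ) :
    IsTwoLevelPolynomial ((X : ℚ[X]) ^ k) (fun _ => ⊤)
      (fun q => chromaticPolynomial ((SimpleGraph.completeGraph (Fin q)).cartesianPower k)) where
  numerical q := ⟨q ^ k, by simp⟩
  eventually_nonneg := Filter.Eventually.of_forall fun q => by
    rw [eval_pow, eval_X]
    positivity
  degree_eq q _ := by
    refine ⟨(chromaticPolynomial_natDegree_and_ne_zero _).1, ?_⟩
    rw [(chromaticPolynomial_natDegree_and_ne_zero _).2]
    simp
  exists_coeff := ⟨codegreePolynomial k, fun q _ r _ =>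
    codegreeCoeff_chromaticPolynomial_cartesianPower k q r⟩
  eq_zero q h := by
    rw [eval_pow, eval_X] at h
    exact absurd h (not_lt.2 (by positivity))
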